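/- Let $K\in\{\mathbb R,\mathbb C,\mathbb H\}$, $d=\dim_{\mathbb R}K$, and let $G(n)$ be respectively $PO(n,1)$, $PU(n,1)$ or $PSp(n,1)$, acting on the $K$-hyperbolic space $\mathbb H^n_K$ (with its standard metric, of curvature $-1$ if $K=\mathbb R$ and in $[-4,-1]$ otherwise) and on its boundary $\partial_\infty\mathbb H^n_K$. Assume $d(n-1)\ge 2$ and $m\ge n$. Let $\Gamma\le G(n)$ be a torsion-free uniform lattice with critical exponent $\delta_\Gamma$, and let $\{\nu_a\}_{a\in\mathbb H^n_K}$ be its Patterson–Sullivan density, i.e. a measurable $\Gamma$-equivariant family of probability measures on $\partial_\infty\mathbb H^n_K$ with $\nu_a\ll\nu_b$ and $\frac{d\nu_a}{d\nu_b}(\xi)=e^{-\delta_\Gamma\beta_b(a,\xi)}$ for all $a,b$, where $\beta_b$ is the Busemann function pointed at $b$. Let $(X,\mu_X)$ be a standard Borel probability space without atoms on which $\Gamma$ acts by measure preserving transformations. A measurable cocycle is a measurable map $\sigma:\Gamma\times X\to G(m)$ with $\sigma(\gamma_1\gamma_2,x)=\sigma(\gamma_1,\gamma_2x)\sigma(\gamma_2,x)$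 for all $\gamma_1,\gamma_2\in\Gamma$ and almost every $x$. A boundary map of $\sigma$ is a measurable map $\phi:\partial_\infty\mathbb H^n_K\times X\to\partial_\infty\mathbb H^m_K$ with $\phi(\gamma\xi,\gamma x)=\sigma(\gamma,x)\phi(\xi,x)$ for all $\gamma\in\Gamma$ and almost all $(\xi,x)$ (null sets of the boundary being those of the measures $\nu_a$). The cocycle $\sigma$ admits a natural map if it has an essentially unique boundary map $\phi$, almost every slice $\phi_x=\phi(\cdot,x)$ of $\phi$ is essentially injective, and there is a measurable map $F:\mathbb H^n_K\times X\to\mathbb H^m_K$ such that, for almost every $x$ and every $a$, $F(a,x)$ is the barycenter of $(\phi_x)_*\nu_a$, that is, the unique minimum point of $y\mapsto\int\beta_o(y,\phi_x(\xi))\,d\nu_a(\xi)$; $F$ is then called the natural map of $\sigma$. The natural volume of $\sigma$ is $$NV(\sigma)=\int_{\Gamma\backslash\mathbb H^n_K}\int_X\sqrt{\det F_x^*g_m}\;d\mu_X(x),$$ where $F_x=F(\cdot,x)$ and $g_m$ is the Riemannian metric of $\mathbb H^m_K$. Let $\sigma:\Gamma\times X\to G(m)$ be a measurable cocycle that admits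 a natural map. For every measurable map $f:X\to G(m)$, the twisted map $\sigma^f(\gamma,x)=f(\gamma x)^{-1}\sigma(\gamma,x)f(x)$ is again a measurable cocycle that admits a natural map, and $$NV(\sigma^f)=NV(\sigma).$$ Hence every measurable cocycle $\sigma'$ cohomologous to $\sigma$ (that is, for some measurable $f:X\to G(m)$ and every $\gamma\in\Gamma$, $\sigma'(\gamma,x)=\sigma^f(\gamma,x)$ for almost every $x$) admits a natural map and satisfies $NV(\sigma')=NV(\sigma)$. -/

import Mathlib

open MeasureTheory Filter Topology
open scoped ENNReal Matrix Quaternion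

noncomputable section

/-- The scalars of the hyperbolic spaces: `K` is one of `ℝ`, `ℂ`, `ℍ`, with its usual
conjugation and absolute value. -/
class HypScalars (K : Type*) [NormedDivisionRing K] [NormedAlgebra ℝ K] [StarRing K] :
    Prop where
  cstar : CStarRing K
  iso : Nonempty (K ≃⋆ₐ[ℝ] ℝ) ∨ Nonempty (K ≃⋆ₐ[ℝ] ℂ) ∨ Nonempty (K ≃⋆ₐ[ℝ] ℍ[ℝ])

instance : HypScalars ℝ := ⟨inferInstance, Or.inl ⟨StarAlgEquiv.refl _ _⟩⟩
instance : HypScalars ℂ := ⟨inferInstance, Or.inr (Or.inl ⟨StarAlgEquiv.refl _ _⟩)⟩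
instance : HypScalars ℍ[ℝ] := ⟨inferInstance, Or.inr (Or.inr ⟨StarAlgEquiv.refl _ _⟩)⟩

namespace NaturalVolume

section Scalars

variable (K : Type*) [NormedDivisionRing K] [NormedAlgebra ℝ K] [StarRing K] [HypScalars K]

instance finiteDimensional_scalars : FiniteDimensional ℝ K := by
  rcases HypScalars.iso (K := K) with ⟨⟨e⟩⟩ | ⟨⟨e⟩⟩ | ⟨⟨e⟩⟩
  · exact Module.Finite.equiv (e.toAlgEquiv.toLinearEquiv).symm
  · exact Module.Finite.equiv (e.toAlgEquiv.toLinearEquiv).symm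
  · exact Module.Finite.equiv (e.toAlgEquiv.toLinearEquiv).symm

variable {K}

theorem star_mul_self_eq (q : K) : star q * q = algebraMap ℝ K (‖q‖ ^ 2) := by
  have : CStarRing K := HypScalars.cstar
  have key : ∃ r : ℝ, 0 ≤ r ∧ star q * q = algebraMap ℝ K r := by
    rcases HypScalars.iso (K := K) with ⟨⟨e⟩⟩ | ⟨⟨e⟩⟩ | ⟨⟨e⟩⟩
    · refine ⟨(e q) ^ 2, sq_nonneg _, (EquivLike.injective e) ?_⟩
      rw [map_mul, map_star]
      have := e.toAlgEquiv.commutes ((e q) ^ 2)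
      change e _ = _ at this
      rw [this]
      simp [pow_two]
    · refine ⟨Complex.normSq (e q), Complex.normSq_nonneg _, (EquivLike.injective e) ?_⟩
      rw [map_mul, map_star]
      have := e.toAlgEquiv.commutes (Complex.normSq (e q))
      change e _ = _ at this
      rw [this]
      simp [Complex.normSq_eq_conj_mul_self]
    · refine ⟨Quaternion.normSq (e q), Quaternion.normSq_nonneg, (EquivLike.injective e) ?_⟩
      rw [map_mul, map_star]
      have := e.toAlgEquiv.commutes (Quaternion.normSq (e q))
      change e _ = _ at this
      rw [this, Quaternion.star_mul_self]
      rfl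
  obtain ⟨r, hr, h⟩ := key
  have h2 : ‖q‖ ^ 2 = r := by
    rw [pow_two, ← CStarRing.norm_star_mul_self, h, norm_algebraMap', Real.norm_of_nonneg hr]
  rw [h, h2]

end Scalars

section Group

variable (K : Type*) [NormedDivisionRing K] [NormedAlgebra ℝ K] [StarRing K]

/-- `Kⁿ` with its Euclidean norm. -/
abbrev Euc (n : ℕ) : Type _ := EuclideanSpace K (Fin n)

/-- Square matrices of size `n + 1`. -/
abbrev HMat (n : ℕ) : Type _ := Matrix (Fin n ⊕ Unit) (Fin n ⊕ Unit) K

/-- The matrix `diag(1, …, 1, -1)`. -/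
def formMatrix (n : ℕ) : HMat K n :=
  Matrix.diagonal (Sum.elim (fun _ => 1) (fun _ => -1))

/-- The unitary group of the form of signature `(n, 1)` over `K`, that is `O(n,1)`, `U(n,1)` or
`Sp(n,1)`. -/
def unitaryForm (n : ℕ) : Subgroup (HMat K n)ˣ where
  carrier := {g | g.1ᴴ * formMatrix K n * g.1 = formMatrix K n}
  one_mem' := by simp
  mul_mem' := by
    intro a b ha hb
    simp only [Set.mem_ofPred_eq] at ha hb ⊢
    rw [Units.val_mul, Matrix.conjTranspose_mul]
    calc _ = b.1ᴴ * (a.1ᴴ * formMatrix K n * a.1) * b.1 := by simp only [Matrix.mul_assoc]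
      _ = _ := by rw [ha, hb]
  inv_mem' := by
    intro a ha
    simp only [Set.mem_ofPred_eq] at ha ⊢
    have h1 : a.1 * a⁻¹.1 = 1 := a.mul_inv
    have h2 : a⁻¹.1ᴴ * a.1ᴴ = 1 := by
      rw [← Matrix.conjTranspose_mul, h1, Matrix.conjTranspose_one]
    calc _ = a⁻¹.1ᴴ * (a.1ᴴ * formMatrix K n * a.1) * a⁻¹.1 := by rw [ha]
      _ = (a⁻¹.1ᴴ * a.1ᴴ) * formMatrix K n * (a.1 * a⁻¹.1) := by simp only [Matrix.mul_assoc]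
      _ = _ := by rw [h1, h2, Matrix.one_mul, Matrix.mul_one]

theorem ne_zero_of_eq_diagonal {n : ℕ} {a : (HMat K n)ˣ} {l : K}
    (h : a.1 = Matrix.diagonal (fun _ => l)) : l ≠ 0 := by
  rintro rfl
  have h1 := a.mul_inv
  rw [h] at h1
  have h2 := congrFun (congrFun h1 (Sum.inr ())) (Sum.inr ())
  simp at h2

/-- The scalar matrices `l • 1` in `unitaryForm K n` with `l` in the centre of `K`. -/
def scalarSubgroup (n : ℕ) : Subgroup (unitaryForm K n) where
  carrier := {g | ∃ l : K, (∀ q : K, l * q = q * l) ∧ g.1.1 = Matrix.diagonal (fun _ => l)}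
  one_mem' := ⟨1, by simp, by simp⟩
  mul_mem' := by
    rintro a b ⟨l, hl, ha⟩ ⟨l', hl', hb⟩
    refine ⟨l * l', fun q => ?_, by simp [ha, hb]⟩
    rw [mul_assoc, hl', ← mul_assoc, hl, mul_assoc]
  inv_mem' := by
    rintro a ⟨l, hl, ha⟩
    have hl0 := ne_zero_of_eq_diagonal K ha
    refine ⟨l⁻¹, fun q => ?_, ?_⟩
    · rw [inv_mul_eq_iff_eq_mul₀ hl0, ← mul_assoc, hl, mul_assoc, mul_inv_cancel₀ hl0, mul_one]
    · have h3 : a.1.1 * Matrix.diagonal (fun _ => l⁻¹) = 1 := by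
        rw [ha, Matrix.diagonal_mul_diagonal]
        simp [hl0]
      simpa using Units.inv_eq_of_mul_eq_one_right h3

instance scalarSubgroup_normal (n : ℕ) : (scalarSubgroup K n).Normal where
  conj_mem := by
    rintro a ⟨l, hl, ha⟩ g
    refine ⟨l, hl, ?_⟩
    have hc : g.1.1 * Matrix.diagonal (fun _ => l) = Matrix.diagonal (fun _ => l) * g.1.1 := by
      ext i j
      rw [Matrix.mul_diagonal, Matrix.diagonal_mul]
      exact (hl _).symm
    have h1 : g.1.1 * g.1⁻¹.1 = 1 := g.1.mul_inv
    simp only [Subgroup.coe_mul, Subgroup.coe_inv, Units.val_mul, ha]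
    rw [hc, Matrix.mul_assoc, h1, Matrix.mul_one]

/-- The group `G(n)`, that is `PO(n,1)`, `PU(n,1)` or `PSp(n,1)`, with the quotient topology. -/
abbrev G (n : ℕ) : Type _ := unitaryForm K n ⧸ scalarSubgroup K n

instance measurableSpaceG (n : ℕ) : MeasurableSpace (G K n) := borel _
instance borelSpaceG (n : ℕ) : BorelSpace (G K n) := ⟨rfl⟩

end Group

section Action

variable {K : Type*} [NormedDivisionRing K] [NormedAlgebra ℝ K] [StarRing K] {n : ℕ}

/-- The vector `(z, 1)` of `K^{n+1}`. -/
def homog (z : Euc K n) : Fin n ⊕ Unit → K := Sum.elim (fun i => z i) (fun _ => 1)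

/-- The projective action in the affine chart: if `g (z, 1) = (w, t)`, the image of `z` is
`w t⁻¹`. -/
def fracLin (g : unitaryForm K n) (z : Euc K n) : Euc K n :=
  WithLp.toLp 2 fun i => (g.1.1 *ᵥ homog z) (Sum.inl i) * ((g.1.1 *ᵥ homog z) (Sum.inr ()))⁻¹

/-- The quadratic form `|v₁|² + ⋯ + |vₙ|² - |vₙ₊₁|²`. -/
def quadForm (v : Fin n ⊕ Unit → K) : ℝ := ∑ i, ‖v (Sum.inl i)‖ ^ 2 - ‖v (Sum.inr ())‖ ^ 2

theorem quadForm_homog (z : Euc K n) : quadForm (homog z) = ‖z‖ ^ 2 - 1 := by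
  simp [quadForm, homog, PiLp.norm_sq_eq_of_L2]

theorem quadForm_mul_right (v : Fin n ⊕ Unit → K) (l : K) :
    quadForm (fun i => v i * l) = quadForm v * ‖l‖ ^ 2 := by
  simp only [quadForm, norm_mul, mul_pow, sub_mul, Finset.sum_mul]

theorem mulVec_mul_right (A : HMat K n) (v : Fin n ⊕ Unit → K)
    (l : K) : A *ᵥ (fun i => v i * l) = fun i => (A *ᵥ v) i * l := by
  ext i
  simp only [Matrix.mulVec, dotProduct, Finset.sum_mul, mul_assoc]

variable [HypScalars K]

theorem algebraMap_quadForm (v : Fin n ⊕ Unit → K) :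
    algebraMap ℝ K (quadForm v) = star v ⬝ᵥ (formMatrix K n *ᵥ v) := by
  simp only [quadForm, formMatrix, map_sub, map_sum, dotProduct, Matrix.mulVec_diagonal,
    Fintype.sum_sum_type, ← star_mul_self_eq]
  simp [sub_eq_add_neg]

theorem quadForm_mulVec (g : unitaryForm K n) (v : Fin n ⊕ Unit → K) :
    quadForm (g.1.1 *ᵥ v) = quadForm v := by
  apply (algebraMap ℝ K).injective
  have hg : (g.1.1)ᴴ * formMatrix K n * g.1.1 = formMatrix K n := g.2
  rw [algebraMap_quadForm, algebraMap_quadForm, Matrix.star_mulVec, ← Matrix.dotProduct_mulVec,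
    Matrix.mulVec_mulVec, Matrix.mulVec_mulVec, hg]

theorem denom_ne_zero (g : unitaryForm K n) {z : Euc K n} (hz : ‖z‖ ≤ 1) :
    (g.1.1 *ᵥ homog z) (Sum.inr ()) ≠ 0 := by
  intro h0
  have h1 : quadForm (g.1.1 *ᵥ homog z) ≤ 0 := by
    rw [quadForm_mulVec, quadForm_homog]
    nlinarith [norm_nonneg z]
  have h2 : ∑ i, ‖(g.1.1 *ᵥ homog z) (Sum.inl i)‖ ^ 2 ≤ 0 := by
    simpa [quadForm, h0] using h1
  have h3 : g.1.1 *ᵥ homog z = 0 := by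
    ext j
    rcases j with i | ⟨⟩
    · have h4 := (Finset.single_le_sum (f := fun i => ‖(g.1.1 *ᵥ homog z) (Sum.inl i)‖ ^ 2)
        (fun i _ => sq_nonneg _) (Finset.mem_univ i)).trans h2
      have h5 := le_antisymm h4 (sq_nonneg _)
      simpa using h5
    · exact h0
  have h6 : homog z = 0 := by
    have h7 : g.1⁻¹.1 *ᵥ (g.1.1 *ᵥ homog z) = homog z := by
      rw [Matrix.mulVec_mulVec, Units.inv_mul, Matrix.one_mulVec]
    rw [← h7, h3, Matrix.mulVec_zero]
  have h8 := congrFun h6 (Sum.inr ())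
  simp [homog] at h8

theorem homog_fracLin (g : unitaryForm K n) {z : Euc K n} (hz : ‖z‖ ≤ 1) :
    homog (fracLin g z) =
      fun i => (g.1.1 *ᵥ homog z) i * ((g.1.1 *ᵥ homog z) (Sum.inr ()))⁻¹ := by
  ext i
  rcases i with i | ⟨⟩
  · simp [homog, fracLin]
  · simp only [mul_inv_cancel₀ (denom_ne_zero g hz)]
    simp [homog]

theorem norm_fracLin (g : unitaryForm K n) {z : Euc K n} (hz : ‖z‖ ≤ 1) :
    1 - ‖fracLin g z‖ ^ 2 =
      (1 - ‖z‖ ^ 2) * ‖((g.1.1 *ᵥ homog z) (Sum.inr ()))⁻¹‖ ^ 2 := by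
  have h := quadForm_homog (fracLin g z)
  rw [homog_fracLin g hz, quadForm_mul_right, quadForm_mulVec, quadForm_homog] at h
  linarith

theorem norm_fracLin_lt (g : unitaryForm K n) {z : Euc K n} (hz : ‖z‖ < 1) :
    ‖fracLin g z‖ < 1 := by
  have h := norm_fracLin g hz.le
  have h1 : 0 < 1 - ‖z‖ ^ 2 := by nlinarith [norm_nonneg z]
  have h2 : 0 < ‖((g.1.1 *ᵥ homog z) (Sum.inr ()))⁻¹‖ :=
    norm_pos_iff.2 (inv_ne_zero (denom_ne_zero g hz.le))
  have h3 : 0 < 1 - ‖fracLin g z‖ ^ 2 := by rw [h]; positivity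
  nlinarith [norm_nonneg (fracLin g z)]

theorem norm_fracLin_eq (g : unitaryForm K n) {z : Euc K n} (hz : ‖z‖ = 1) :
    ‖fracLin g z‖ = 1 := by
  have h := norm_fracLin g hz.le
  rw [hz] at h
  have h1 : ‖fracLin g z‖ ^ 2 = 1 := by linarith
  nlinarith [norm_nonneg (fracLin g z)]

theorem fracLin_one (z : Euc K n) : fracLin 1 z = z := by
  ext i
  simp [fracLin, homog]

theorem fracLin_mul (g h : unitaryForm K n) {z : Euc K n} (hz : ‖z‖ ≤ 1) :
    fracLin (g * h) z = fracLin g (fracLin h z) := by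
  have hd := denom_ne_zero h hz
  ext i
  simp only [fracLin]
  change _ = (g.1.1 *ᵥ homog (fracLin h z)) (Sum.inl i) *
    ((g.1.1 *ᵥ homog (fracLin h z)) (Sum.inr ()))⁻¹
  rw [homog_fracLin h hz, mulVec_mul_right]
  simp only [Matrix.mulVec_mulVec, Subgroup.coe_mul, Units.val_mul]
  rw [mul_inv_rev, inv_inv, mul_assoc, inv_mul_cancel_left₀ hd]

theorem fracLin_scalar {g : unitaryForm K n} (hg : g ∈ scalarSubgroup K n) (z : Euc K n) :
    fracLin g z = z := by
  obtain ⟨l, hl, h⟩ := hg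
  have hl0 := ne_zero_of_eq_diagonal K h
  ext i
  simp only [fracLin, h, Matrix.mulVec_diagonal]
  rw [hl]
  simp [homog, hl0]

end Action

section Spaces

variable (K : Type*) [NormedDivisionRing K] [NormedAlgebra ℝ K] [StarRing K] (n : ℕ)

/-- The `n`-dimensional hyperbolic space over `K`: the unit ball of `Kⁿ`, a point `z` standing for
the negative line spanned by `(z, 1)`. -/
def Hyp : Type _ := {z : Euc K n // ‖z‖ < 1}

/-- The boundary at infinity of `Hyp K n`: the unit sphere of `Kⁿ`. -/
def Bd : Type _ := {z : Euc K n // ‖z‖ = 1}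

instance : TopologicalSpace (Hyp K n) := instTopologicalSpaceSubtype
instance : TopologicalSpace (Bd K n) := instTopologicalSpaceSubtype
instance : MeasurableSpace (Hyp K n) := borel _
instance : MeasurableSpace (Bd K n) := borel _
instance : BorelSpace (Hyp K n) := ⟨rfl⟩
instance : BorelSpace (Bd K n) := ⟨rfl⟩

/-- The base point, the centre of the ball. -/
def basept : Hyp K n := ⟨0, by simp⟩

instance : Nonempty (Hyp K n) := ⟨basept K n⟩

variable [HypScalars K]

instance : MulAction (unitaryForm K n) (Hyp K n) where
  smul g z := ⟨fracLin g z.1, norm_fracLin_lt g z.2⟩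
  one_smul z := Subtype.ext (fracLin_one z.1)
  mul_smul g h z := Subtype.ext (fracLin_mul g h z.2.le)

instance : MulAction (unitaryForm K n) (Bd K n) where
  smul g z := ⟨fracLin g z.1, norm_fracLin_eq g z.2⟩
  one_smul z := Subtype.ext (fracLin_one z.1)
  mul_smul g h z := Subtype.ext (fracLin_mul g h z.2.le)

/-- `G(n)` acts on the hyperbolic space through the fractional linear action. -/
instance : MulAction (G K n) (Hyp K n) :=
  MulAction.compHom _ (QuotientGroup.lift (scalarSubgroup K n)
    (MulAction.toPermHom (unitaryForm K n) (Hyp K n))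
    (fun _ hg => Equiv.ext fun z => Subtype.ext (fracLin_scalar hg z.1)))

/-- `G(n)` acts on the boundary at infinity through the fractional linear action. -/
instance : MulAction (G K n) (Bd K n) :=
  MulAction.compHom _ (QuotientGroup.lift (scalarSubgroup K n)
    (MulAction.toPermHom (unitaryForm K n) (Bd K n))
    (fun _ hg => Equiv.ext fun z => Subtype.ext (fracLin_scalar hg z.1)))

theorem mk_smul_hyp (g : unitaryForm K n) (z : Hyp K n) :
    (((QuotientGroup.mk g : G K n) • z : Hyp K n)).1 = fracLin g z.1 := rfl

theorem mk_smul_bd (g : unitaryForm K n) (z : Bd K n) :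
    (((QuotientGroup.mk g : G K n) • z : Bd K n)).1 = fracLin g z.1 := rfl

end Spaces

section Geometry

variable {K : Type*} [NormedDivisionRing K] [NormedAlgebra ℝ K] [StarRing K] {n : ℕ}

/-- The positive definite Hermitian product of `Kⁿ`. -/
def herm (z w : Euc K n) : K := ∑ i, star (z i) * w i

/-- The hyperbolic distance, normalized so that the sectional curvature is `-1` over `ℝ` and lies
between `-4` and `-1` over `ℂ` and `ℍ`. -/
def hdist (a b : Hyp K n) : ℝ :=
  Real.arcosh (‖1 - herm a.1 b.1‖ / (√(1 - ‖a.1‖ ^ 2) * √(1 - ‖b.1‖ ^ 2)))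

/-- The quadratic form on the tangent space `Kⁿ` at `a` of the Riemannian metric whose distance is
`hdist`. -/
def metricQ (a : Hyp K n) (u : Euc K n) : ℝ :=
  ((1 - ‖a.1‖ ^ 2) * ‖u‖ ^ 2 + ‖herm a.1 u‖ ^ 2) / (1 - ‖a.1‖ ^ 2) ^ 2

/-- The Riemannian metric at `a`, the polarization of `metricQ a`. -/
def metric (a : Hyp K n) (u v : Euc K n) : ℝ :=
  (metricQ a (u + v) - metricQ a (u - v)) / 4

/-- `c`, restricted to `[0, ∞)`, is a unit speed geodesic ray from `b` to the boundary point `ξ`. -/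
structure IsGeodesicRay (c : ℝ → Hyp K n) (b : Hyp K n) (ξ : Bd K n) : Prop where
  start : c 0 = b
  isometric : ∀ s t : ℝ, 0 ≤ s → 0 ≤ t → hdist (c s) (c t) = |s - t|
  tendsto : Tendsto (fun t => (c t).1) atTop (𝓝 ξ.1)

/-- A geodesic ray from `b` to `ξ`. -/
def ray (b : Hyp K n) (ξ : Bd K n) : ℝ → Hyp K n :=
  Classical.epsilon fun c => IsGeodesicRay c b ξ

/-- The Busemann function `β_b(a, ξ)` pointed at `b`. -/
def busemann (b a : Hyp K n) (ξ : Bd K n) : ℝ :=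
  limUnder atTop fun t : ℝ => hdist a (ray b ξ t) - hdist b (ray b ξ t)

/-- The function `Λ_ν`, the average of the Busemann functions pointed at the base point. -/
def avgBusemann (ν : Measure (Bd K n)) (y : Hyp K n) : ℝ :=
  ∫ ξ, busemann (basept K n) y ξ ∂ν

/-- `y` is the barycenter of `ν`: the unique point where `Λ_ν` attains its minimum. -/
def IsBarycenter (ν : Measure (Bd K n)) (y : Hyp K n) : Prop :=
  ∀ z, z ≠ y → avgBusemann ν y < avgBusemann ν z

variable [HypScalars K]

/-- The critical exponent of `Γ`, through the Poincaré series at the base point. -/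
def criticalExponent (Γ : Subgroup (G K n)) : ℝ :=
  sInf {s : ℝ | 0 < s ∧
    Summable fun γ : Γ => Real.exp (-s * hdist (γ • basept K n) (basept K n))}

/-- `α`-conformal densities of `Γ`. -/
structure IsConformalDensity (Γ : Subgroup (G K n)) (α : ℝ)
    (ν : Hyp K n → Measure (Bd K n)) : Prop where
  measurable : Measurable ν
  isProb : ∀ a, IsProbabilityMeasure (ν a)
  equivariant : ∀ (γ : Γ) (a : Hyp K n), ν (γ • a) = (ν a).map (fun ξ => γ • ξ)
  absCont : ∀ a b, ν a ≪ ν b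
  rnDeriv_eq : ∀ a b, (ν a).rnDeriv (ν b) =ᵐ[ν b]
    fun ξ => ENNReal.ofReal (Real.exp (-α * busemann b a ξ))

/-- Patterson–Sullivan densities of `Γ`. -/
def IsPattersonSullivan (Γ : Subgroup (G K n)) (ν : Hyp K n → Measure (Bd K n)) : Prop :=
  0 < criticalExponent Γ ∧ IsConformalDensity Γ (criticalExponent Γ) ν

/-- Torsion-free uniform lattices of `G(n)`: torsion-free, discrete, cocompact subgroups. -/
structure IsTorsionFreeUniformLattice (Γ : Subgroup (G K n)) : Prop where
  discrete : DiscreteTopology Γ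
  cocompact : CompactSpace (G K n ⧸ Γ)
  torsionFree : ∀ γ ∈ Γ, IsOfFinOrder γ → γ = 1

end Geometry

section Cocycles

variable {K : Type*} [NormedDivisionRing K] [NormedAlgebra ℝ K] [StarRing K] [HypScalars K]
  {n m : ℕ} {Γ : Subgroup (G K n)} {X : Type*} [MeasurableSpace X] [MulAction Γ X]

/-- Measurable cocycles `σ : Γ × X → G(m)` for a countable discrete `Γ`. -/
structure IsCocycle (μ : Measure X) (σ : Γ → X → G K m) : Prop where
  measurable : ∀ γ, Measurable (σ γ)
  cocycle : ∀ γ₁ γ₂ : Γ, ∀ᵐ x ∂μ, σ (γ₁ * γ₂) x = σ γ₁ (γ₂ • x) * σ γ₂ x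

/-- The twisted cocycle `σ^f`. -/
def twist (σ : Γ → X → G K m) (f : X → G K m) : Γ → X → G K m :=
  fun γ x => (f (γ • x))⁻¹ * σ γ x * f x

/-- `σ₂` is cohomologous to `σ₁`; cocycles that agree almost everywhere are identified. -/
def Cohomologous (μ : Measure X) (σ₁ σ₂ : Γ → X → G K m) : Prop :=
  ∃ f : X → G K m, Measurable f ∧ ∀ γ, ∀ᵐ x ∂μ, σ₂ γ x = twist σ₁ f γ x

/-- Boundary maps of `σ`. The null sets of the boundary are those of the measure `ν₀`. -/
structure IsBoundaryMap (μ : Measure X) (ν₀ : Measure (Bd K n)) (σ : Γ → X → G K m)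
    (φ : Bd K n × X → Bd K m) : Prop where
  measurable : Measurable φ
  equivariant : ∀ γ : Γ, ∀ᵐ p ∂(ν₀.prod μ), φ (γ • p.1, γ • p.2) = σ γ p.2 • φ p

/-- `φ` is an essentially unique boundary map of `σ` with essentially injective slices. -/
structure IsEssUniqueInjectiveBoundaryMap (μ : Measure X) (ν₀ : Measure (Bd K n))
    (σ : Γ → X → G K m) (φ : Bd K n × X → Bd K m) : Prop
    extends IsBoundaryMap μ ν₀ σ φ where
  essUnique : ∀ ψ, IsBoundaryMap μ ν₀ σ ψ → ψ =ᵐ[ν₀.prod μ] φ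
  essInjective : ∀ᵐ x ∂μ, ∃ s ∈ ae ν₀, Set.InjOn (fun ξ => φ (ξ, x)) s

/-- `F` is the natural map of the cocycle `σ`: `F(a, x)` is the barycenter of the push-forward of
`ν_a` by the slice `φ_x` of the essentially unique boundary map `φ` of `σ`, whose slices are
essentially injective. Here `ν` is the Patterson–Sullivan density of `Γ`; all its members have the
same null sets, and these are the null sets of the boundary. -/
structure IsNaturalMap (μ : Measure X) (ν : Hyp K n → Measure (Bd K n)) (σ : Γ → X → G K m)
    (F : Hyp K n × X → Hyp K m) : Prop where
  measurable : Measurable F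
  barycenter : ∃ φ : Bd K n × X → Bd K m,
    IsEssUniqueInjectiveBoundaryMap μ (ν (basept K n)) σ φ ∧
    ∀ᵐ x ∂μ, ∀ a, IsBarycenter ((ν a).map fun ξ => φ (ξ, x)) (F (a, x))

/-- `σ` admits a natural map. -/
def AdmitsNaturalMap (μ : Measure X) (ν : Hyp K n → Measure (Bd K n)) (σ : Γ → X → G K m) :
    Prop :=
  ∃ F, IsNaturalMap μ ν σ F

end Cocycles

section Volume

variable (K : Type*) [NormedDivisionRing K] [NormedAlgebra ℝ K] [StarRing K] [HypScalars K]
  (n : ℕ)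

/-- A real basis of `Kⁿ`, giving global coordinates of the hyperbolic space. -/
def coordBasis : Module.Basis (Fin (Module.finrank ℝ (Euc K n))) ℝ (Euc K n) :=
  Module.finBasis ℝ (Euc K n)

/-- Lebesgue measure on the ball in the coordinates of `coordBasis`. -/
def lebesgue : Measure (Hyp K n) :=
  letI : MeasurableSpace (Euc K n) := borel _
  haveI : BorelSpace (Euc K n) := ⟨rfl⟩
  (coordBasis K n).addHaar.comap (fun z : Hyp K n => z.1)

variable {K n} {m : ℕ}

/-- The derivative at `a` of a map between hyperbolic spaces. -/
def hderiv (Ψ : Hyp K n → Hyp K m) (a : Hyp K n) : Euc K n →L[ℝ] Euc K m :=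
  fderiv ℝ (Function.extend (fun z : Hyp K n => z.1) (fun z => (Ψ z).1) 0) a.1

/-- The value `ω(u₁, …, u_p)` at `a` of the volume form `ω = √(det Ψ^* g_m)` on the coordinate
basis `u₁, …, u_p` of the tangent space. -/
def pullbackVolume (Ψ : Hyp K n → Hyp K m) (a : Hyp K n) : ℝ :=
  √(Matrix.det (Matrix.of fun i j : Fin (Module.finrank ℝ (Euc K n)) =>
    metric (Ψ a) (hderiv Ψ a (coordBasis K n i)) (hderiv Ψ a (coordBasis K n j))))

/-- A fundamental domain for the action of `Γ` on the hyperbolic space. -/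
def fundDomain (Γ : Subgroup (G K n)) : Set (Hyp K n) :=
  Classical.epsilon fun D => IsFundamentalDomain Γ D (lebesgue K n)

variable {X : Type*} [MeasurableSpace X]

/-- The volume of an equivariant map `Φ : Hyp K n × X → Hyp K m`, that is the integral over
`Γ \ Hyp K n` (computed on a fundamental domain, in coordinates) of the form `∫_X ω_x dμ(x)`. -/
def vol (Γ : Subgroup (G K n)) (μ : Measure X) (Φ : Hyp K n × X → Hyp K m) : ℝ≥0∞ :=
  ∫⁻ a in fundDomain Γ, ∫⁻ x, ENNReal.ofReal (pullbackVolume (fun b => Φ (b, x)) a) ∂μ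
    ∂(lebesgue K n)

open Classical in
/-- The natural volume of the cocycle `σ`, the volume of its natural map (and `0` by convention
if there is none). -/
def naturalVolume {Γ : Subgroup (G K n)} [MulAction Γ X] (μ : Measure X)
    (ν : Hyp K n → Measure (Bd K n)) (σ : Γ → X → G K m) : ℝ≥0∞ :=
  if h : AdmitsNaturalMap μ ν σ then vol Γ μ h.choose else 0

end Volume

end NaturalVolume

end

/-!
The group `G(m)` acts on the ball by isometries, so composing `F_x` with an element of `G(m)` that
may depend on `x` does not change the density `√(det F_x^* g_m)`. It acts on the boundary with
`β_o(g y, g ξ) = β_o(y, ξ) + β_o(g o, g ξ)`; the last term does not depend on `y`, so barycenters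
are equivariant. Hence, if `φ` is the boundary map of `σ` and `F` its natural map, then `f⁻¹ φ` and
`f⁻¹ F` satisfy the same conditions for `σ^f`; essential uniqueness passes from `φ` to `f⁻¹ φ`
because twisting by `f⁻¹` undoes the twist by `f`. Finally the natural map is determined for almost
every `x`, because `φ` is essentially unique and barycenters are unique, so the natural volume of
`σ^f` may be computed with `f⁻¹ F`.
-/

noncomputable section

namespace NaturalVolume

attribute [local instance] HypScalars.cstar

instance starModule_scalars (K : Type*) [NormedDivisionRing K] [NormedAlgebra ℝ K] [StarRing K]
    [HypScalars K] : StarModule ℝ K where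
  star_smul r q := by
    rcases HypScalars.iso (K := K) with ⟨⟨e⟩⟩ | ⟨⟨e⟩⟩ | ⟨⟨e⟩⟩ <;>
      exact EquivLike.injective e (by simp [map_star, map_smul])

section HermitianProduct

variable {K : Type*} [NormedDivisionRing K] [NormedAlgebra ℝ K] [StarRing K] [HypScalars K] {n : ℕ}

theorem norm_herm_le (z w : Euc K n) : ‖herm z w‖ ≤ ‖z‖ * ‖w‖ := by
  calc ‖herm z w‖ ≤ ∑ i, ‖z i‖ * ‖w i‖ :=
        norm_sum_le_of_le _ fun i _ => by rw [norm_mul, norm_star]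
    _ ≤ √(∑ i, ‖z i‖ ^ 2) * √(∑ i, ‖w i‖ ^ 2) := Real.sum_mul_le_sqrt_mul_sqrt _ _ _
    _ = ‖z‖ * ‖w‖ := by rw [PiLp.norm_eq_of_L2, PiLp.norm_eq_of_L2]

theorem norm_one_sub_herm_pos {z w : Euc K n} (hz : ‖z‖ < 1) (hw : ‖w‖ ≤ 1) :
    0 < ‖1 - herm z w‖ := by
  refine norm_pos_iff.2 (sub_ne_zero.2 fun h => ?_)
  have h_le := norm_herm_le z w
  rw [← h, norm_one] at h_le
  nlinarith [norm_nonneg z, norm_nonneg w]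

theorem herm_smul_smul (s t : ℝ) (z : Euc K n) :
    herm (s • z) (t • z) = algebraMap ℝ K (s * t * ‖z‖ ^ 2) := by
  simp only [herm, PiLp.smul_apply, star_smul, star_trivial, smul_mul_smul_comm, star_mul_self_eq]
  rw [← Finset.smul_sum, ← map_sum, PiLp.norm_sq_eq_of_L2, Algebra.smul_def, ← map_mul]

end HermitianProduct

theorem continuous_herm_right {K : Type*} [NormedDivisionRing K] [StarRing K] {n : ℕ}
    (z : Euc K n) : Continuous (herm z) := by
  unfold herm
  fun_prop

section HermitianForm

variable {K : Type*} [NormedDivisionRing K] [StarRing K] {n : ℕ}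

/-- The Hermitian form of signature `(n, 1)` on `K^{n+1}`, conjugate linear in its first argument;
the scalars act on `K^{n+1}` from the right. -/
def hermForm (v w : Fin n ⊕ Unit → K) : K := star v ⬝ᵥ (formMatrix K n *ᵥ w)

theorem hermForm_eq (v w : Fin n ⊕ Unit → K) :
    hermForm v w = ∑ i, star (v (Sum.inl i)) * w (Sum.inl i) -
      star (v (Sum.inr ())) * w (Sum.inr ()) := by
  simp [hermForm, formMatrix, dotProduct, Matrix.mulVec_diagonal, sub_eq_add_neg]

theorem star_hermForm (v w : Fin n ⊕ Unit → K) : star (hermForm v w) = hermForm w v := by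
  simp [hermForm_eq]

theorem hermForm_add_right (u v w : Fin n ⊕ Unit → K) :
    hermForm u (v + w) = hermForm u v + hermForm u w := by
  simp [hermForm, Matrix.mulVec_add]

theorem hermForm_add_left (u v w : Fin n ⊕ Unit → K) :
    hermForm (u + v) w = hermForm u w + hermForm v w := by
  simp [hermForm, add_dotProduct]

theorem hermForm_mul_right (v w : Fin n ⊕ Unit → K) (l : K) :
    hermForm v (fun i => w i * l) = hermForm v w * l := by
  simp only [hermForm_eq, sub_mul, Finset.sum_mul, mul_assoc]

theorem hermForm_mul_left (v w : Fin n ⊕ Unit → K) (l : K) :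
    hermForm (fun i => v i * l) w = star l * hermForm v w := by
  rw [← star_hermForm, hermForm_mul_right, star_mul, star_hermForm]

theorem hermForm_homog (z w : Euc K n) : hermForm (homog z) (homog w) = herm z w - 1 := by
  simp [hermForm_eq, homog, herm]

theorem hermForm_mulVec (g : unitaryForm K n) (v w : Fin n ⊕ Unit → K) :
    hermForm (g.1.1 *ᵥ v) (g.1.1 *ᵥ w) = hermForm v w := by
  have hg : (g.1.1)ᴴ * formMatrix K n * g.1.1 = formMatrix K n := g.2
  rw [hermForm, hermForm, Matrix.star_mulVec, ← Matrix.dotProduct_mulVec,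
    Matrix.mulVec_mulVec, Matrix.mulVec_mulVec, hg]

/-- Minus the Gram determinant of `v` and `w` for the form `hermForm`. The Riemannian metric at the
negative line spanned by `v` is `w ↦ negGram v w / quadForm v ^ 2`. -/
def negGram (v w : Fin n ⊕ Unit → K) : ℝ := ‖hermForm v w‖ ^ 2 - quadForm v * quadForm w

variable [NormedAlgebra ℝ K]

theorem negGram_mul_right (v w : Fin n ⊕ Unit → K) (l : K) :
    negGram v (fun i => w i * l) = negGram v w * ‖l‖ ^ 2 := by
  simp only [negGram, quadForm_mul_right, hermForm_mul_right, norm_mul]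
  ring

variable [HypScalars K]

theorem negGram_mul_left (v w : Fin n ⊕ Unit → K) (l : K) :
    negGram (fun i => v i * l) w = negGram v w * ‖l‖ ^ 2 := by
  simp only [negGram, quadForm_mul_right, hermForm_mul_left, norm_mul, norm_star]
  ring

theorem algebraMap_negGram (v w : Fin n ⊕ Unit → K) :
    algebraMap ℝ K (negGram v w) =
      hermForm w v * hermForm v w - hermForm v v * hermForm w w := by
  have hermForm_self (v : Fin n ⊕ Unit → K) : hermForm v v = algebraMap ℝ K (quadForm v) :=
    (algebraMap_quadForm v).symm
  rw [negGram, map_sub, map_mul, ← hermForm_self, ← hermForm_self, ← star_mul_self_eq,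
    star_hermForm]

theorem negGram_add_mul (v w : Fin n ⊕ Unit → K) (l : K) :
    negGram v (w + fun i => v i * l) = negGram v w := by
  have h_central (q : K) : q * hermForm v v = hermForm v v * q := by
    rw [hermForm, ← algebraMap_quadForm]
    exact (Algebra.commutes _ _).symm
  apply (algebraMap ℝ K).injective
  simp only [algebraMap_negGram, hermForm_add_left, hermForm_add_right, hermForm_mul_left,
    hermForm_mul_right]
  have h_central_star := h_central (star l)
  generalize hermForm v v = q at *
  simp only [mul_add, add_mul, ← mul_assoc, h_central_star, h_central]
  abel

theorem negGram_mulVec (g : unitaryForm K n) (v w : Fin n ⊕ Unit → K) :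
    negGram (g.1.1 *ᵥ v) (g.1.1 *ᵥ w) = negGram v w := by
  simp only [negGram, quadForm_mulVec, hermForm_mulVec]

end HermitianForm

section Derivative

variable {K : Type*} [NormedDivisionRing K] {n : ℕ}

/-- The vector `(u, 0)` of `K^{n+1}`, the derivative of `homog` in the direction `u`. -/
def tangentVec (u : Euc K n) : Fin n ⊕ Unit → K := Sum.elim (fun i => u i) (fun _ => 0)

variable [NormedAlgebra ℝ K]

/-- The real linear map `u ↦ (A (u, 0))ᵢ`, the derivative of the `i`-th homogeneous coordinate of
`A (z, 1)` with respect to `z`. -/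
def tangentRow (A : HMat K n) (i : Fin n ⊕ Unit) : Euc K n →L[ℝ] K :=
  ∑ j, (ContinuousLinearMap.mul ℝ K (A i (Sum.inl j))).comp (PiLp.proj 2 (fun _ => K) j)

theorem tangentRow_apply (A : HMat K n) (i : Fin n ⊕ Unit) (u : Euc K n) :
    tangentRow A i u = (A *ᵥ tangentVec u) i := by
  simp [tangentRow, Matrix.mulVec, dotProduct, tangentVec]

theorem hasFDerivAt_mulVec_homog (A : HMat K n) (i : Fin n ⊕ Unit) (z : Euc K n) :
    HasFDerivAt (fun z => (A *ᵥ homog z) i) (tangentRow A i) z := by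
  have h_affine : (fun z => (A *ᵥ homog z) i) = fun z => tangentRow A i z + A i (Sum.inr ()) := by
    ext z
    simp [tangentRow, Matrix.mulVec, dotProduct, homog]
  rw [h_affine]
  exact (tangentRow A i).hasFDerivAt.add_const _

variable [StarRing K]

theorem metricQ_eq_negGram (a : Hyp K n) (u : Euc K n) :
    metricQ a u = negGram (homog a.1) (tangentVec u) / quadForm (homog a.1) ^ 2 := by
  have h_quadForm : quadForm (tangentVec u) = ‖u‖ ^ 2 := by
    simp [quadForm, tangentVec, PiLp.norm_sq_eq_of_L2]
  have h_hermForm : hermForm (homog a.1) (tangentVec u) = herm a.1 u := by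
    simp [hermForm_eq, homog, tangentVec, herm]
  rw [metricQ, negGram, h_quadForm, h_hermForm, quadForm_homog]
  congr 1 <;> ring

/-- The denominator of the fractional linear action of `g` at `z`, its automorphy factor. -/
abbrev denom (g : unitaryForm K n) (z : Euc K n) : K := (g.1.1 *ᵥ homog z) (Sum.inr ())

/-- The derivative of `fracLin g` at `z`: where `g (z, 1) = (w, t)` it sends `dz` to
`(dw - w t⁻¹ dt) t⁻¹`. -/
def fracLinDeriv (g : unitaryForm K n) (z : Euc K n) : Euc K n →L[ℝ] Euc K n :=
  (PiLp.continuousLinearEquiv 2 ℝ fun _ : Fin n => K).symm.toContinuousLinearMap ∘L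
    ContinuousLinearMap.pi fun i => (ContinuousLinearMap.mul ℝ K).flip (denom g z)⁻¹ ∘L
      (tangentRow g.1.1 (Sum.inl i) -
        ContinuousLinearMap.mul ℝ K (fracLin g z i) ∘L tangentRow g.1.1 (Sum.inr ()))

theorem tangentVec_fracLinDeriv (g : unitaryForm K n) (z u : Euc K n) :
    tangentVec (fracLinDeriv g z u) = fun i =>
      (g.1.1 *ᵥ tangentVec u + fun j =>
        homog (fracLin g z) j * -(g.1.1 *ᵥ tangentVec u) (Sum.inr ())) i * (denom g z)⁻¹ := by
  ext i
  rcases i with i | ⟨⟩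
  · simp [tangentVec, fracLinDeriv, tangentRow_apply, homog, sub_eq_add_neg, add_mul, mul_assoc]
  · simp [tangentVec, homog]

variable [HypScalars K]

theorem hasFDerivAt_fracLin (g : unitaryForm K n) {z : Euc K n} (hz : ‖z‖ ≤ 1) :
    HasFDerivAt (fracLin g) (fracLinDeriv g z) z := by
  have h_inv := (hasFDerivAt_inv' (𝕜 := ℝ) (denom_ne_zero g hz)).comp z
    (hasFDerivAt_mulVec_homog g.1.1 (Sum.inr ()) z)
  rw [← hasFDerivWithinAt_univ, hasFDerivWithinAt_piLp]
  intro i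
  rw [hasFDerivWithinAt_univ]
  refine ((hasFDerivAt_mulVec_homog g.1.1 (Sum.inl i) z).mul' h_inv).congr_fderiv ?_
  ext u
  simp [fracLinDeriv, fracLin, mul_assoc, sub_eq_neg_add]

-- The term `-w t⁻¹ dt` of the derivative is a multiple of the base vector, so `negGram` ignores it.
theorem metricQ_smul_fracLinDeriv (g : unitaryForm K n) (a : Hyp K n) (u : Euc K n) :
    metricQ (g • a) (fracLinDeriv g a.1 u) = metricQ a u := by
  have h_denom : ‖(denom g a.1)⁻¹‖ ≠ 0 :=
    norm_ne_zero_iff.2 (inv_ne_zero (denom_ne_zero g a.2.le))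
  have h_smul : (g • a).1 = fracLin g a.1 := rfl
  rw [metricQ_eq_negGram, metricQ_eq_negGram, h_smul, tangentVec_fracLinDeriv,
    negGram_mul_right, negGram_add_mul, homog_fracLin g a.2.le, negGram_mul_left, negGram_mulVec,
    quadForm_mul_right, quadForm_mulVec]
  field_simp

theorem metric_smul_fracLinDeriv (g : unitaryForm K n) (a : Hyp K n) (u v : Euc K n) :
    metric (g • a) (fracLinDeriv g a.1 u) (fracLinDeriv g a.1 v) = metric a u v := by
  simp only [metric, ← map_add, ← map_sub, metricQ_smul_fracLinDeriv]

end Derivative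

section PullbackVolume

variable {K : Type*} [NormedDivisionRing K] {n m : ℕ}

/-- The extension by zero to `Kⁿ` of a map between hyperbolic spaces; `hderiv` is defined as its
Fréchet derivative. -/
def zeroExtend (Ψ : Hyp K n → Hyp K m) : Euc K n → Euc K m :=
  Function.extend (fun z : Hyp K n => z.1) (fun z => (Ψ z).1) 0

theorem zeroExtend_apply (Ψ : Hyp K n → Hyp K m) (a : Hyp K n) : zeroExtend Ψ a.1 = (Ψ a).1 :=
  Subtype.val_injective.extend_apply (fun z => (Ψ z).1) 0 a

variable [NormedAlgebra ℝ K] [StarRing K] [HypScalars K]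

theorem zeroExtend_smul_eventuallyEq (g : unitaryForm K m) (Ψ : Hyp K n → Hyp K m) (a : Hyp K n) :
    zeroExtend (fun z => g • Ψ z) =ᶠ[𝓝 a.1] fracLin g ∘ zeroExtend Ψ := by
  have h_ball : {z : Euc K n | ‖z‖ < 1} ∈ 𝓝 a.1 :=
    (isOpen_lt continuous_norm continuous_const).mem_nhds a.2
  filter_upwards [h_ball] with z hz
  exact (zeroExtend_apply (fun z => g • Ψ z) ⟨z, hz⟩).trans
    (congrArg (fracLin g) (zeroExtend_apply Ψ ⟨z, hz⟩)).symm

theorem hasFDerivAt_zeroExtend_smul (g : unitaryForm K m) {Ψ : Hyp K n → Hyp K m} {a : Hyp K n}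
    {L : Euc K n →L[ℝ] Euc K m} (hΨ : HasFDerivAt (zeroExtend Ψ) L a.1) :
    HasFDerivAt (zeroExtend fun z => g • Ψ z) (fracLinDeriv g (Ψ a).1 ∘L L) a.1 := by
  have hg := hasFDerivAt_fracLin g (Ψ a).2.le
  rw [← zeroExtend_apply Ψ a] at hg ⊢
  exact (hg.comp a.1 hΨ).congr_of_eventuallyEq (zeroExtend_smul_eventuallyEq g Ψ a)

theorem differentiableAt_zeroExtend_smul_iff (g : unitaryForm K m) {Ψ : Hyp K n → Hyp K m}
    {a : Hyp K n} :
    DifferentiableAt ℝ (zeroExtend fun z => g • Ψ z) a.1 ↔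
      DifferentiableAt ℝ (zeroExtend Ψ) a.1 := by
  refine ⟨fun h => ?_, fun h => (hasFDerivAt_zeroExtend_smul g h.hasFDerivAt).differentiableAt⟩
  simpa only [inv_smul_smul] using
    (hasFDerivAt_zeroExtend_smul g⁻¹ h.hasFDerivAt).differentiableAt

theorem hderiv_smul (g : unitaryForm K m) (Ψ : Hyp K n → Hyp K m) (a : Hyp K n) :
    hderiv (fun z => g • Ψ z) a = fracLinDeriv g (Ψ a).1 ∘L hderiv Ψ a := by
  by_cases h : DifferentiableAt ℝ (zeroExtend Ψ) a.1
  · exact (hasFDerivAt_zeroExtend_smul g h.hasFDerivAt).fderiv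
  · have h_smul : hderiv (fun z => g • Ψ z) a = 0 :=
      fderiv_zero_of_not_differentiableAt (mt (differentiableAt_zeroExtend_smul_iff g).1 h)
    have h_zero : hderiv Ψ a = 0 := fderiv_zero_of_not_differentiableAt h
    rw [h_smul, h_zero, ContinuousLinearMap.comp_zero]

theorem pullbackVolume_smul (g : G K m) (Ψ : Hyp K n → Hyp K m) (a : Hyp K n) :
    pullbackVolume (fun z => g • Ψ z) a = pullbackVolume Ψ a := by
  obtain ⟨g, rfl⟩ := QuotientGroup.mk_surjective g
  change pullbackVolume (fun z => g • Ψ z) a = _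
  simp only [pullbackVolume, hderiv_smul, ContinuousLinearMap.comp_apply, metric_smul_fracLinDeriv]

end PullbackVolume

section GroupTopology

theorem secondCountableTopology_units (M : Type*) [TopologicalSpace M] [Monoid M]
    [SecondCountableTopology M] : SecondCountableTopology Mˣ :=
  have : SecondCountableTopology Mᵐᵒᵖ := MulOpposite.opHomeomorph.symm.secondCountableTopology
  Units.isEmbedding_embedProduct.secondCountableTopology

variable (K : Type*) [NormedDivisionRing K] [NormedAlgebra ℝ K] [StarRing K] [HypScalars K] (n : ℕ)

instance secondCountableTopology_G : SecondCountableTopology (G K n) :=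
  have : ProperSpace K := FiniteDimensional.proper ℝ K
  have : SecondCountableTopology (HMat K n) :=
    inferInstanceAs (SecondCountableTopology (Fin n ⊕ Unit → Fin n ⊕ Unit → K))
  have : SecondCountableTopology (HMat K n)ˣ := secondCountableTopology_units _
  have : SecondCountableTopology (unitaryForm K n) :=
    TopologicalSpace.Subtype.secondCountableTopology _
  inferInstance

variable {K n} in
theorem continuousOn_fracLin :
    ContinuousOn (fun p : unitaryForm K n × Euc K n => fracLin p.1 p.2) {p | ‖p.2‖ ≤ 1} := by
  have h_homog : Continuous (homog : Euc K n → Fin n ⊕ Unit → K) :=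
    continuous_pi fun j => by
      rcases j with j | ⟨⟩ <;> simp only [homog, Sum.elim_inl, Sum.elim_inr] <;> fun_prop
  have h_coord (i) : Continuous fun p : unitaryForm K n × Euc K n => (p.1.1.1 *ᵥ homog p.2) i :=
    (continuous_apply i).comp <|
      (Units.continuous_val.comp (continuous_subtype_val.comp continuous_fst)).matrix_mulVec
        (h_homog.comp continuous_snd)
  exact (PiLp.continuous_toLp 2 _).comp_continuousOn <| continuousOn_pi.2 fun i =>
    (h_coord _).continuousOn.mul ((h_coord _).continuousOn.inv₀ fun p hp => denom_ne_zero p.1 hp)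

instance continuousSMul_hyp : ContinuousSMul (G K n) (Hyp K n) where
  continuous_smul := by
    rw [← (QuotientGroup.isOpenQuotientMap_mk.prodMap .id).continuous_comp_iff]
    exact (continuousOn_fracLin.comp_continuous (continuous_id.prodMap continuous_subtype_val)
      fun p : unitaryForm K n × Hyp K n => p.2.2.le).subtype_mk _

instance continuousSMul_bd : ContinuousSMul (G K n) (Bd K n) where
  continuous_smul := by
    rw [← (QuotientGroup.isOpenQuotientMap_mk.prodMap .id).continuous_comp_iff]
    exact (continuousOn_fracLin.comp_continuous (continuous_id.prodMap continuous_subtype_val)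
      fun p : unitaryForm K n × Bd K n => p.2.2.le).subtype_mk _

instance compactSpace_bd : CompactSpace (Bd K n) := by
  have : ProperSpace (Euc K n) := FiniteDimensional.proper ℝ _
  have h_sphere : IsCompact {z : Euc K n | ‖z‖ = 1} := by
    simpa [Metric.sphere] using isCompact_sphere (0 : Euc K n) 1
  exact isCompact_iff_compactSpace.1 h_sphere

end GroupTopology

section HyperbolicFunctions

theorem one_sub_tanh_sq (t : ℝ) : 1 - Real.tanh t ^ 2 = (Real.cosh t)⁻¹ ^ 2 := by
  have h_cosh := (Real.cosh_pos t).ne'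
  rw [Real.tanh_eq_sinh_div_cosh]
  field_simp
  linarith [Real.cosh_sq t]

theorem one_sub_tanh_mul_tanh (s t : ℝ) :
    1 - Real.tanh s * Real.tanh t = Real.cosh (s - t) * ((Real.cosh s)⁻¹ * (Real.cosh t)⁻¹) := by
  have hs := (Real.cosh_pos s).ne'
  have ht := (Real.cosh_pos t).ne'
  rw [Real.cosh_sub, Real.tanh_eq_sinh_div_cosh, Real.tanh_eq_sinh_div_cosh]
  field_simp

theorem tendsto_tanh_atTop : Tendsto Real.tanh atTop (𝓝 1) := by
  have h_sub (t : ℝ) : 1 - Real.tanh t = Real.exp (-t) / Real.cosh t := by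
    rw [← Real.cosh_sub_sinh, Real.tanh_eq_sinh_div_cosh, sub_div, div_self (Real.cosh_pos t).ne']
  have h_zero : Tendsto (fun t => 1 - Real.tanh t) atTop (𝓝 0) := by
    refine squeeze_zero (fun t => ?_) (fun t => ?_) Real.tendsto_exp_neg_atTop_nhds_zero
    · exact sub_nonneg.2 (Real.tanh_lt_one t).le
    · exact h_sub t ▸ div_le_self (Real.exp_pos _).le (Real.one_le_cosh t)
  simpa using h_zero.const_sub 1

theorem arcosh_div {x s : ℝ} (hx : 0 < x) (hs : 0 < s) :
    Real.arcosh (x / s) = Real.log (x + √(x ^ 2 - s ^ 2)) - Real.log s := by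
  have h_sqrt : √((x / s) ^ 2 - 1) = √(x ^ 2 - s ^ 2) / s := by
    rw [← Real.sqrt_sq hs.le, ← Real.sqrt_div' _ (sq_nonneg s), Real.sqrt_sq hs.le]
    congr 1
    field_simp
  rw [Real.arcosh, h_sqrt, ← add_div, Real.log_div (by positivity) hs.ne']

end HyperbolicFunctions

section RadialRay

variable {K : Type*} [NormedDivisionRing K] {n : ℕ}

theorem sqrt_one_sub_norm_sq_pos (a : Hyp K n) : 0 < √(1 - ‖a.1‖ ^ 2) :=
  Real.sqrt_pos.2 (by nlinarith [norm_nonneg a.1, a.2])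

variable [NormedAlgebra ℝ K]

theorem norm_smul_bd (r : ℝ) (ξ : Bd K n) : ‖r • ξ.1‖ = |r| := by
  rw [norm_smul, ξ.2, mul_one, Real.norm_eq_abs]

/-- The unit speed geodesic from the centre of the ball towards `ξ`. -/
def radialRay (ξ : Bd K n) (t : ℝ) : Hyp K n :=
  ⟨Real.tanh t • ξ.1, by rw [norm_smul_bd]; exact Real.abs_tanh_lt_one t⟩

theorem sqrt_one_sub_norm_sq_radialRay (ξ : Bd K n) (t : ℝ) :
    √(1 - ‖(radialRay ξ t).1‖ ^ 2) = (Real.cosh t)⁻¹ := by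
  rw [radialRay, norm_smul_bd, sq_abs, one_sub_tanh_sq,
    Real.sqrt_sq (inv_nonneg.2 (Real.cosh_pos t).le)]

variable [StarRing K] [HypScalars K]

theorem hdist_radialRay (ξ : Bd K n) (s t : ℝ) :
    hdist (radialRay ξ s) (radialRay ξ t) = |s - t| := by
  have h_norm : ‖1 - herm (radialRay ξ s).1 (radialRay ξ t).1‖ =
      Real.cosh (s - t) * ((Real.cosh s)⁻¹ * (Real.cosh t)⁻¹) := by
    rw [radialRay, radialRay, herm_smul_smul, ξ.2, one_pow, mul_one, ← map_one (algebraMap ℝ K),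
      ← map_sub, norm_algebraMap', one_sub_tanh_mul_tanh, Real.norm_of_nonneg (by positivity)]
  rw [hdist, h_norm, sqrt_one_sub_norm_sq_radialRay, sqrt_one_sub_norm_sq_radialRay,
    mul_div_cancel_right₀ _ (by positivity), ← Real.cosh_abs, Real.arcosh_cosh (abs_nonneg _)]

theorem isGeodesicRay_radialRay (ξ : Bd K n) : IsGeodesicRay (radialRay ξ) (basept K n) ξ where
  start := Subtype.ext (by simp [radialRay, basept])
  isometric s t _ _ := hdist_radialRay ξ s t
  tendsto := by simpa [radialRay] using tendsto_tanh_atTop.smul_const ξ.1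

theorem isGeodesicRay_ray_basept (ξ : Bd K n) :
    IsGeodesicRay (ray (basept K n) ξ) (basept K n) ξ :=
  Classical.epsilon_spec (p := fun c => IsGeodesicRay c (basept K n) ξ)
    ⟨_, isGeodesicRay_radialRay ξ⟩

end RadialRay

section Busemann

variable {K : Type*} [NormedDivisionRing K] [StarRing K] {n : ℕ}

/-- The function of `a` whose level sets are the horospheres centred at `ξ` when `‖ξ‖ = 1`,
normalized to be `1` at the centre of the ball. It is defined for every vector `ξ` because the
distance from `a` to a point `z` of the ball is governed by `horo a z`. -/
def horo (a : Hyp K n) (ξ : Euc K n) : ℝ := ‖1 - herm a.1 ξ‖ / √(1 - ‖a.1‖ ^ 2)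

theorem horo_basept (ξ : Euc K n) : horo (basept K n) ξ = 1 := by
  simp [horo, basept, herm]

theorem continuous_horo (a : Hyp K n) : Continuous (horo a) :=
  ((continuous_const.sub (continuous_herm_right a.1)).norm).div_const _

variable [NormedAlgebra ℝ K] [HypScalars K]

theorem horo_pos (a : Hyp K n) {ξ : Euc K n} (hξ : ‖ξ‖ ≤ 1) : 0 < horo a ξ :=
  div_pos (norm_one_sub_herm_pos a.2 hξ) (sqrt_one_sub_norm_sq_pos a)

theorem norm_one_sub_herm_fracLin (g : unitaryForm K n) {z w : Euc K n} (hz : ‖z‖ ≤ 1)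
    (hw : ‖w‖ ≤ 1) :
    ‖1 - herm (fracLin g z) (fracLin g w)‖ =
      ‖1 - herm z w‖ * ‖(denom g z)⁻¹‖ * ‖(denom g w)⁻¹‖ := by
  rw [norm_sub_rev, ← hermForm_homog, homog_fracLin g hz, homog_fracLin g hw, hermForm_mul_left,
    hermForm_mul_right, hermForm_mulVec, hermForm_homog, norm_mul, norm_mul, norm_star,
    norm_sub_rev 1]
  ring

theorem horo_smul (g : unitaryForm K n) (a : Hyp K n) {ξ : Euc K n} (hξ : ‖ξ‖ ≤ 1) :
    horo (g • a) (fracLin g ξ) = horo a ξ * ‖(denom g ξ)⁻¹‖ := by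
  have h_denom : ‖(denom g a.1)⁻¹‖ ≠ 0 :=
    norm_ne_zero_iff.2 (inv_ne_zero (denom_ne_zero g a.2.le))
  have h_sqrt := (sqrt_one_sub_norm_sq_pos a).ne'
  have h_smul : (g • a).1 = fracLin g a.1 := rfl
  rw [horo, horo, h_smul, norm_one_sub_herm_fracLin g a.2.le hξ, norm_fracLin g a.2.le,
    Real.sqrt_mul' _ (sq_nonneg _), Real.sqrt_sq (norm_nonneg _)]
  field_simp

theorem hdist_eq_log_horo (a z : Hyp K n) :
    hdist a z = Real.log (horo a z.1 + √(horo a z.1 ^ 2 - √(1 - ‖z.1‖ ^ 2) ^ 2)) -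
      Real.log √(1 - ‖z.1‖ ^ 2) := by
  rw [← arcosh_div (horo_pos a z.2.le) (sqrt_one_sub_norm_sq_pos z), hdist, horo, div_div]

theorem tendsto_hdist_add_log {ι : Type*} {l : Filter ι} {c : ι → Hyp K n} {ξ : Bd K n}
    (hc : Tendsto (fun t => (c t).1) l (𝓝 ξ.1)) (a : Hyp K n) :
    Tendsto (fun t => hdist a (c t) + Real.log √(1 - ‖(c t).1‖ ^ 2)) l
      (𝓝 (Real.log (2 * horo a ξ.1))) := by
  have h_pos := horo_pos a ξ.2.le
  have h_horo := ((continuous_horo a).tendsto ξ.1).comp hc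
  have h_sqrt : Tendsto (fun t => √(1 - ‖(c t).1‖ ^ 2)) l (𝓝 0) := by
    simpa [ξ.2] using ((hc.norm.pow 2).const_sub 1).sqrt
  have h_sum := h_horo.add ((h_horo.pow 2).sub (h_sqrt.pow 2)).sqrt
  rw [zero_pow two_ne_zero, sub_zero, Real.sqrt_sq h_pos.le, ← two_mul] at h_sum
  refine (h_sum.log (by positivity)).congr fun t => ?_
  rw [hdist_eq_log_horo, sub_add_cancel]
  rfl

theorem tendsto_hdist_sub_hdist {ι : Type*} {l : Filter ι} {c : ι → Hyp K n} {ξ : Bd K n}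
    (hc : Tendsto (fun t => (c t).1) l (𝓝 ξ.1)) (a b : Hyp K n) :
    Tendsto (fun t => hdist a (c t) - hdist b (c t)) l
      (𝓝 (Real.log (horo a ξ.1) - Real.log (horo b ξ.1))) := by
  have h_sub := (tendsto_hdist_add_log hc a).sub (tendsto_hdist_add_log hc b)
  rwa [Real.log_mul two_ne_zero (horo_pos a ξ.2.le).ne',
    Real.log_mul two_ne_zero (horo_pos b ξ.2.le).ne', add_sub_add_left_eq_sub,
    funext fun t => add_sub_add_right_eq_sub _ _ _] at h_sub

theorem busemann_basept (a : Hyp K n) (ξ : Bd K n) :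
    busemann (basept K n) a ξ = Real.log (horo a ξ.1) := by
  rw [busemann, (tendsto_hdist_sub_hdist (isGeodesicRay_ray_basept ξ).tendsto a _).limUnder_eq,
    horo_basept, Real.log_one, sub_zero]

theorem busemann_smul (g : G K n) (a : Hyp K n) (ξ : Bd K n) :
    busemann (basept K n) (g • a) (g • ξ) =
      busemann (basept K n) a ξ + busemann (basept K n) (g • basept K n) (g • ξ) := by
  obtain ⟨g, rfl⟩ := QuotientGroup.mk_surjective g
  have h_denom : ‖(denom g ξ.1)⁻¹‖ ≠ 0 :=
    norm_ne_zero_iff.2 (inv_ne_zero (denom_ne_zero g ξ.2.le))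
  have h_horo (a : Hyp K n) : horo ((g : G K n) • a) ((g : G K n) • ξ).1 =
      horo a ξ.1 * ‖(denom g ξ.1)⁻¹‖ := horo_smul g a ξ.2.le
  rw [busemann_basept, busemann_basept, busemann_basept, h_horo, h_horo, horo_basept, one_mul,
    Real.log_mul (horo_pos a ξ.2.le).ne' h_denom]

theorem continuous_busemann_basept (a : Hyp K n) :
    Continuous fun ξ : Bd K n => busemann (basept K n) a ξ := by
  simp only [busemann_basept]
  exact ((continuous_horo a).comp continuous_subtype_val).log fun ξ => (horo_pos a ξ.2.le).ne'

end Busemann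

section Barycenter

variable {K : Type*} [NormedDivisionRing K] [StarRing K] {n : ℕ}

theorem IsBarycenter.unique {ν : Measure (Bd K n)} {y z : Hyp K n} (hy : IsBarycenter ν y)
    (hz : IsBarycenter ν z) : y = z := by
  by_contra h_ne
  exact lt_asymm (hy z (Ne.symm h_ne)) (hz y h_ne)

variable [NormedAlgebra ℝ K] [HypScalars K] {ν : Measure (Bd K n)} [IsFiniteMeasure ν]

variable (ν) in
theorem integrable_busemann_basept (a : Hyp K n) :
    Integrable (fun ξ => busemann (basept K n) a ξ) ν :=
  (continuous_busemann_basept a).integrable_of_hasCompactSupport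
    (HasCompactSupport.of_compactSpace _)

variable (ν) in
theorem avgBusemann_map_smul (g : G K n) (y : Hyp K n) :
    avgBusemann (ν.map fun ξ => g • ξ) (g • y) =
      avgBusemann ν y + avgBusemann (ν.map fun ξ => g • ξ) (g • basept K n) := by
  have hg : AEMeasurable (fun ξ : Bd K n => g • ξ) ν := (continuous_const_smul g).aemeasurable
  have h_map (z : Hyp K n) : avgBusemann (ν.map fun ξ => g • ξ) z =
      ∫ ξ, busemann (basept K n) z (g • ξ) ∂ν :=
    integral_map hg (continuous_busemann_basept z).aestronglyMeasurable
  have h_int : Integrable (fun ξ => busemann (basept K n) (g • basept K n) (g • ξ)) ν :=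
    (integrable_busemann_basept (ν.map fun ξ => g • ξ) _).comp_aemeasurable hg
  simp only [h_map, busemann_smul g y]
  exact integral_add (integrable_busemann_basept ν y) h_int

theorem IsBarycenter.map_smul {y : Hyp K n} (hy : IsBarycenter ν y) (g : G K n) :
    IsBarycenter (ν.map fun ξ => g • ξ) (g • y) := by
  intro z hz
  have h_lt := hy (g⁻¹ • z) fun h => hz (by rw [← h, smul_inv_smul])
  have h_avg := avgBusemann_map_smul ν g (g⁻¹ • z)
  rw [smul_inv_smul] at h_avg
  rw [h_avg, avgBusemann_map_smul ν g y]
  exact add_lt_add_left h_lt _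

end Barycenter

section Twist

variable {K : Type*} [NormedDivisionRing K] [NormedAlgebra ℝ K] [StarRing K] {n m : ℕ}
  {Γ : Subgroup (G K n)} {X : Type*} [MulAction Γ X]

theorem twist_twist_inv (σ : Γ → X → G K m) (f : X → G K m) : twist (twist σ f) f⁻¹ = σ := by
  ext γ x
  simp only [twist, Pi.inv_apply]
  group

variable [MeasurableSpace X] {μ : Measure X} {σ σ' : Γ → X → G K m} {f : X → G K m}

theorem cohomologous_twist (hf : Measurable f) : Cohomologous μ σ (twist σ f) :=
  ⟨f, hf, fun _ => .of_forall fun _ => rfl⟩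

variable [HypScalars K] {ν₀ : Measure (Bd K n)} {φ : Bd K n × X → Bd K m}

theorem IsCocycle.twist (hσ : IsCocycle μ σ) (hΓ : ∀ γ : Γ, Measurable fun x : X => γ • x)
    (hf : Measurable f) : IsCocycle μ (twist σ f) where
  measurable γ := ((hf.comp (hΓ γ)).inv.mul (hσ.measurable γ)).mul hf
  cocycle γ₁ γ₂ := by
    filter_upwards [hσ.cocycle γ₁ γ₂] with x hx
    simp only [NaturalVolume.twist, hx, mul_smul]
    group

theorem IsBoundaryMap.twist (hφ : IsBoundaryMap μ ν₀ σ φ) (hf : Measurable f) :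
    IsBoundaryMap μ ν₀ (twist σ f) fun p => (f p.2)⁻¹ • φ p where
  measurable := (hf.comp measurable_snd).inv.smul hφ.measurable
  equivariant γ := by
    filter_upwards [hφ.equivariant γ] with p hp
    simp only [NaturalVolume.twist, hp, ← mul_smul]
    group

theorem IsEssUniqueInjectiveBoundaryMap.twist (hφ : IsEssUniqueInjectiveBoundaryMap μ ν₀ σ φ)
    (hf : Measurable f) :
    IsEssUniqueInjectiveBoundaryMap μ ν₀ (twist σ f) fun p => (f p.2)⁻¹ • φ p where
  toIsBoundaryMap := hφ.toIsBoundaryMap.twist hf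
  essUnique ψ hψ := by
    have h_untwist := hψ.twist hf.inv
    rw [twist_twist_inv] at h_untwist
    filter_upwards [hφ.essUnique _ h_untwist] with p hp
    simp only [Pi.inv_apply, inv_inv] at hp
    rw [← hp, inv_smul_smul]
  essInjective := by
    filter_upwards [hφ.essInjective] with x ⟨s, hs, h_inj⟩
    exact ⟨s, hs, fun ξ hξ η hη h_eq => h_inj hξ hη (MulAction.injective _ h_eq)⟩

theorem IsBoundaryMap.congr_ae [SFinite μ] (hφ : IsBoundaryMap μ ν₀ σ φ)
    (hσ : ∀ γ, σ' γ =ᵐ[μ] σ γ) : IsBoundaryMap μ ν₀ σ' φ where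
  measurable := hφ.measurable
  equivariant γ := by
    filter_upwards [hφ.equivariant γ, Measure.quasiMeasurePreserving_snd.ae (hσ γ)] with p hp hpσ
    rw [hp, hpσ]

theorem IsEssUniqueInjectiveBoundaryMap.congr_ae [SFinite μ]
    (hφ : IsEssUniqueInjectiveBoundaryMap μ ν₀ σ φ) (hσ : ∀ γ, σ' γ =ᵐ[μ] σ γ) :
    IsEssUniqueInjectiveBoundaryMap μ ν₀ σ' φ where
  toIsBoundaryMap := hφ.toIsBoundaryMap.congr_ae hσ
  essUnique ψ hψ := hφ.essUnique ψ (hψ.congr_ae fun γ => (hσ γ).symm)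
  essInjective := hφ.essInjective

end Twist

section NaturalMap

variable {K : Type*} [NormedDivisionRing K] [NormedAlgebra ℝ K] [StarRing K] [HypScalars K]
  {n m : ℕ} {Γ : Subgroup (G K n)} {X : Type*} [MeasurableSpace X] {μ : Measure X}

theorem vol_congr_ae {F F' : Hyp K n × X → Hyp K m} (h : ∀ᵐ x ∂μ, ∀ a, F (a, x) = F' (a, x)) :
    vol Γ μ F = vol Γ μ F' := by
  refine lintegral_congr fun a => lintegral_congr_ae ?_
  filter_upwards [h] with x hx
  simp only [hx]

theorem vol_smul (F : Hyp K n × X → Hyp K m) (f : X → G K m) :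
    vol Γ μ (fun p => f p.2 • F p) = vol Γ μ F :=
  lintegral_congr fun a => lintegral_congr fun x =>
    congrArg _ (pullbackVolume_smul (f x) (fun b => F (b, x)) a)

variable [MulAction Γ X] {ν : Hyp K n → Measure (Bd K n)} {σ σ' : Γ → X → G K m}
  {F F' : Hyp K n × X → Hyp K m}

theorem IsNaturalMap.congr_ae [SFinite μ] (hF : IsNaturalMap μ ν σ F)
    (hσ : ∀ γ, σ' γ =ᵐ[μ] σ γ) : IsNaturalMap μ ν σ' F := by
  obtain ⟨φ, hφ, h_bar⟩ := hF.barycenter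
  exact ⟨hF.measurable, φ, hφ.congr_ae hσ, h_bar⟩

theorem IsNaturalMap.twist [∀ a, IsFiniteMeasure (ν a)] (hF : IsNaturalMap μ ν σ F)
    {f : X → G K m} (hf : Measurable f) :
    IsNaturalMap μ ν (twist σ f) fun p => (f p.2)⁻¹ • F p := by
  obtain ⟨φ, hφ, h_bar⟩ := hF.barycenter
  refine ⟨(hf.comp measurable_snd).inv.smul hF.measurable, _, hφ.twist hf, ?_⟩
  filter_upwards [h_bar] with x hx a
  have h_slice : Measurable fun ξ => φ (ξ, x) := hφ.measurable.comp measurable_prodMk_right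
  have h_smul := (hx a).map_smul (f x)⁻¹
  rwa [Measure.map_map (continuous_const_smul _).measurable h_slice] at h_smul

theorem IsNaturalMap.ae_eq [SFinite μ] [SFinite (ν (basept K n))]
    (hν : ∀ a, ν a ≪ ν (basept K n)) (hF : IsNaturalMap μ ν σ F) (hF' : IsNaturalMap μ ν σ F') :
    ∀ᵐ x ∂μ, ∀ a, F (a, x) = F' (a, x) := by
  obtain ⟨φ, hφ, h_bar⟩ := hF.barycenter
  obtain ⟨φ', hφ', h_bar'⟩ := hF'.barycenter
  have h_slices : ∀ᵐ x ∂μ, ∀ᵐ ξ ∂(ν (basept K n)), φ (ξ, x) = φ' (ξ, x) := by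
    have h_unique := hφ'.essUnique φ hφ.toIsBoundaryMap
    rw [← Measure.prod_swap] at h_unique
    exact Measure.ae_ae_of_ae_prod (ae_of_ae_map measurable_swap.aemeasurable h_unique)
  filter_upwards [h_slices, h_bar, h_bar'] with x hx hxF hxF' a
  have h_map : (ν a).map (fun ξ => φ (ξ, x)) = (ν a).map fun ξ => φ' (ξ, x) :=
    Measure.map_congr ((hν a).ae_le hx)
  exact (hxF a).unique (h_map ▸ hxF' a)

theorem IsNaturalMap.naturalVolume_eq [SFinite μ] [SFinite (ν (basept K n))]
    (hν : ∀ a, ν a ≪ ν (basept K n)) (hF : IsNaturalMap μ ν σ F) :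
    naturalVolume μ ν σ = vol Γ μ F := by
  have h_admits : AdmitsNaturalMap μ ν σ := ⟨F, hF⟩
  rw [naturalVolume, dif_pos h_admits]
  exact vol_congr_ae (h_admits.choose_spec.ae_eq hν hF)

variable [SFinite μ] [∀ a, IsFiniteMeasure (ν a)]

theorem AdmitsNaturalMap.of_cohomologous (hF : AdmitsNaturalMap μ ν σ)
    (h : Cohomologous μ σ σ') : AdmitsNaturalMap μ ν σ' := by
  obtain ⟨F, hF⟩ := hF
  obtain ⟨f, hf, hσ'⟩ := h
  exact ⟨_, (hF.twist hf).congr_ae hσ'⟩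

theorem naturalVolume_eq_of_cohomologous (hν : ∀ a, ν a ≪ ν (basept K n))
    (hF : AdmitsNaturalMap μ ν σ) (h : Cohomologous μ σ σ') :
    naturalVolume μ ν σ' = naturalVolume μ ν σ := by
  obtain ⟨F, hF⟩ := hF
  obtain ⟨f, hf, hσ'⟩ := h
  calc naturalVolume μ ν σ' = vol Γ μ fun p => (f p.2)⁻¹ • F p :=
        ((hF.twist hf).congr_ae hσ').naturalVolume_eq hν
    _ = vol Γ μ F := vol_smul F f⁻¹
    _ = naturalVolume μ ν σ := (hF.naturalVolume_eq hν).symm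

end NaturalMap

end NaturalVolume

end

open NaturalVolume in
theorem mainTheorem6_general {K : Type*} [NormedDivisionRing K] [NormedAlgebra ℝ K] [StarRing K]
    [HypScalars K] {n m : ℕ} {Γ : Subgroup (G K n)} [DiscreteTopology Γ] {α : ℝ}
    {ν : Hyp K n → Measure (Bd K n)} (hν : IsConformalDensity Γ α ν)
    {X : Type*} [MeasurableSpace X] {μ : Measure X} [SFinite μ] [MulAction Γ X]
    (hX : ∀ γ : Γ, MeasurePreserving (fun x : X => γ • x) μ μ)
    {σ : Γ → X → G K m} (hσ : IsCocycle μ σ) (hF : AdmitsNaturalMap μ ν σ) :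
    (∀ f : X → G K m, Measurable f →
      IsCocycle μ (twist σ f) ∧ AdmitsNaturalMap μ ν (twist σ f) ∧
      naturalVolume μ ν (twist σ f) = naturalVolume μ ν σ) ∧
    (∀ σ' : Γ → X → G K m, Cohomologous μ σ σ' →
      AdmitsNaturalMap μ ν σ' ∧ naturalVolume μ ν σ' = naturalVolume μ ν σ) := by
  have h_prob := hν.isProb
  have h_cohomologous (σ' : Γ → X → G K m) (h : Cohomologous μ σ σ') :
      AdmitsNaturalMap μ ν σ' ∧ naturalVolume μ ν σ' = naturalVolume μ ν σ :=
    ⟨hF.of_cohomologous h,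
      naturalVolume_eq_of_cohomologous (fun a => hν.absCont a _) hF h⟩
  exact ⟨fun f hf => ⟨hσ.twist (fun γ => (hX γ).measurable) hf,
    h_cohomologous _ (cohomologous_twist hf)⟩, h_cohomologous⟩

theorem mainTheorem6 {K : Type*} [NormedDivisionRing K] [NormedAlgebra ℝ K] [StarRing K]
    [HypScalars K] (n m : ℕ) (hn : 2 ≤ Module.finrank ℝ K * (n - 1)) (hnm : n ≤ m)
    (Γ : Subgroup (NaturalVolume.G K n)) (hΓ : NaturalVolume.IsTorsionFreeUniformLattice Γ)
    (ν : NaturalVolume.Hyp K n → MeasureTheory.Measure (NaturalVolume.Bd K n))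
    (hν : NaturalVolume.IsPattersonSullivan Γ ν)
    {X : Type*} [MeasurableSpace X] [StandardBorelSpace X] (μ : MeasureTheory.Measure X)
    [MeasureTheory.IsProbabilityMeasure μ] [MeasureTheory.NullSingletonClass μ] [MulAction Γ X]
    (hX : ∀ γ : Γ, MeasureTheory.MeasurePreserving (fun x : X => γ • x) μ μ)
    (σ : Γ → X → NaturalVolume.G K m) (hσ : NaturalVolume.IsCocycle μ σ)
    (hF : NaturalVolume.AdmitsNaturalMap μ ν σ) :
    (∀ f : X → NaturalVolume.G K m, Measurable f →
      NaturalVolume.IsCocycle μ (NaturalVolume.twist σ f) ∧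
      NaturalVolume.AdmitsNaturalMap μ ν (NaturalVolume.twist σ f) ∧
      NaturalVolume.naturalVolume μ ν (NaturalVolume.twist σ f) =
        NaturalVolume.naturalVolume μ ν σ) ∧
    (∀ σ' : Γ → X → NaturalVolume.G K m, NaturalVolume.IsCocycle μ σ' →
      NaturalVolume.Cohomologous μ σ σ' →
      NaturalVolume.AdmitsNaturalMap μ ν σ' ∧
      NaturalVolume.naturalVolume μ ν σ' = NaturalVolume.naturalVolume μ ν σ) := by
  have := hΓ.discrete
  have h_general := mainTheorem6_general hν.2 hX hσ hF
  exact ⟨h_general.1, fun σ' _ => h_general.2 σ'⟩
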